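/- Let $G$ be a group. A $G$-system is a compact metrizable space on which $G$ acts by homeomorphisms; products carry the diagonal action, and a factor map is a continuous surjective $G$-equivariant map. A system is minimal if every $G$-orbit is dense. A system $X$ is distal if, whenever the orbit closure of a pair $(x_1,x_2)$ in $X\times X$ meets the diagonal, $x_1=x_2$. It is weakly mixing if $X\times X$ is topologically transitive, i.e. for all nonempty open $U,V\subseteq X\times X$ there is $g\in G$ with $gU\cap V\neq\emptyset$. The enveloping semigroup $E(X,G)$ is the closure of $\{x\mapsto gx : g\in G\}$ in the product space $X^X$, with $G$ acting by $(gf)(x)=g\,f(x)$; it is a compact, not necessarily metrizable, space with $G$ acting by homeomorphisms. A minimal $Y$ is disjoint from $E(X,G)$ if $Y\times E(X,G)$ is minimal. **Theorem.** Let $X$ be a minimal distal $G$-system and let $Y$ be a minimal $G$-system. 1. If $Y$ is weakly mixing, then $Y$ is disjoint from $(E(X,G),G)$. 2. Suppose that $Y$ is disjoint from $(E(X,G),G)$. Let $Q$ be a $G$-system with factor maps $\phi: Y\times X\to Q$ and $\theta: Q\to Y$ such that $\theta\circ\phi$ is the projection $\pi_Y:Y\times X\to Y$. Then there are a $G$-system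 $Z$ that is a factor of $X$ (there is a factor map $X\to Z$) and a $G$-equivariant homeomorphism $h: Q\to Y\times Z$ such that $\theta(q)$ is the first coordinate of $h(q)$ for every $q\in Q$. -/

import Mathlib

universe u v w

/-!
Topological dynamical systems of an (abstract) group `G`.  A system is a compact space `X` with a
`MulAction G X` and `ContinuousConstSMul G X`, that is, a homomorphism from `G` to the
self-homeomorphisms of `X`.  Minimality (every orbit is dense) is Mathlib's `MulAction.IsMinimal`,
and products carry Mathlib's diagonal action.
-/

namespace TopDyn

/-- A factor map of `G`-systems: a continuous, surjective, equivariant map. -/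
structure IsFactorMap (G : Type*) {X Y : Type*} [Group G]
    [TopologicalSpace X] [MulAction G X] [TopologicalSpace Y] [MulAction G Y]
    (π : X → Y) : Prop where
  continuous : Continuous π
  surjective : Function.Surjective π
  map_smul : ∀ (g : G) (x : X), π (g • x) = g • π x

/-- The proximal relation: the pairs whose orbit closure in `X × X` meets the diagonal. -/
def proximalRelation (G X : Type*) [Group G] [TopologicalSpace X] [MulAction G X] :
    Set (X × X) :=
  {p | (closure (MulAction.orbit G p) ∩ Set.diagonal X).Nonempty}

/-- A system is distal when its proximal relation is the diagonal. -/
def IsDistal (G X : Type*) [Group G] [TopologicalSpace X] [MulAction G X] : Prop :=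
  proximalRelation G X = Set.diagonal X

/-- Two minimal systems are disjoint when their product, with the diagonal action, is minimal. -/
def AreDisjoint (G X Y : Type*) [Group G] [TopologicalSpace X] [MulAction G X]
    [TopologicalSpace Y] [MulAction G Y] : Prop :=
  MulAction.IsMinimal G (X × Y)

/-- A system `Y` is weakly mixing when `Y × Y`, with the diagonal action, is topologically
transitive. -/
def IsWeaklyMixing (G Y : Type*) [Group G] [TopologicalSpace Y] [MulAction G Y] : Prop :=
  MulAction.IsTopologicallyTransitive G (Y × Y)

/-- The enveloping semigroup `E(X, G)`: the closure of the set of translations `x ↦ g • x` in the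
product space `X ^ X` (pointwise convergence), as a `G`-invariant subset of `X ^ X`, where `G` acts
by `(g • f) x = g • f x`.  It is a `G`-system with the subspace topology. -/
def EnvelopingSemigroup (G X : Type*) [Group G] [TopologicalSpace X] [MulAction G X]
    [ContinuousConstSMul G X] : SubMulAction G (X → X) where
  carrier := closure (Set.range fun (g : G) (x : X) => g • x)
  smul_mem' := by
    intro g f hf
    refine map_mem_closure (f := fun f : X → X => g • f) (continuous_const_smul g) hf ?_
    rintro _ ⟨h, rfl⟩
    exact ⟨g * h, funext fun x => mul_smul g h x⟩

end TopDyn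

/-!
Throughout, `b ∈ closure (orbit G a)` is read as "`a` reaches `b`"; this is a preorder on any
system, and it is pushed forward, and lifted along maps out of compact systems, by continuous
equivariant maps.

**Disjointness.** Let `E = E(X, G)`.  Every nonempty closed subsemigroup of `E` contains an
idempotent, and when `X` is distal an idempotent `u` of `E` is the identity since `x` and `u x` are
proximal.  So such a subsemigroup contains the identity, and applying this to left ideals shows
that it is closed under inverses; in particular `E` is a group (Ellis).  Applied to
`{s | (y, id) reaches (y, s)}`, the same fact shows that reaching is *symmetric* on `Y × E`
whenever `Y` is minimal; that is, `Y × E` is partitioned into minimal sets.  If `Y` is weakly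
mixing, Baire's theorem gives a pair `(y₁, y₂)` with dense orbit in `Y × Y`.  Since the pair
reaches `(y₁, y₁)`, some `q ∈ E` has `(y₁, q)` reached from both `(y₁, id)` and `(y₂, id)`, so these
two points are equivalent.  Since the pair also reaches an arbitrary `(y, y')`, the points `(y, q)`
and `(y', q)` are equivalent for some `q ∈ E`, and so, after multiplying on the right by `q⁻¹ r`,
are `(y, r)` and `(y', r)` for every `r`.  As `E` is minimal, all of `Y × E` is one class.

**Factors of `Y × X` over `Y`.** If `Y × E` is minimal then `(y, id)` reaches `(y', id)` for all
`y, y'`: some net `gᵢ` moves `y` to `y'` while `gᵢ → id` pointwise on `X`.  Applying `gᵢ` to an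
equality `φ (y, x) = φ (y, x')` and passing to the limit gives `φ (y', x) = φ (y', x')`.  So the
equivalence relation that `φ` induces on the fibre `X` over `y` does not depend on `y`, and `Z` is
the quotient of `X` by it.
-/

open MulAction Topology

namespace TopDyn

/-! ### Orbit closures and equivariant maps -/

section Orbits

theorem image_orbit_of_map_smul {G A B : Type*} [Group G] [MulAction G A] [MulAction G B]
    {f : A → B} (hs : ∀ (g : G) (a : A), f (g • a) = g • f a)
    (a : A) : f '' orbit G a = orbit G (f a) := by
  ext b
  constructor
  · rintro ⟨_, ⟨g, rfl⟩, rfl⟩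
    exact ⟨g, (hs g a).symm⟩
  · rintro ⟨g, rfl⟩
    exact ⟨g • a, ⟨g, rfl⟩, hs g a⟩

variable {G A B : Type*} [Group G]
  [TopologicalSpace A] [MulAction G A] [TopologicalSpace B] [MulAction G B]

theorem mem_closure_orbit_self (a : A) : a ∈ closure (orbit G a) :=
  subset_closure (mem_orbit_self a)

theorem mem_closure_orbit_trans [ContinuousConstSMul G A] {a b c : A}
    (hab : b ∈ closure (orbit G a)) (hbc : c ∈ closure (orbit G b)) :
    c ∈ closure (orbit G a) := by
  refine closure_minimal ?_ isClosed_closure hbc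
  rintro _ ⟨g, rfl⟩
  refine map_mem_closure (f := fun x : A => g • x) (continuous_const_smul g) hab ?_
  rintro _ ⟨k, rfl⟩
  exact ⟨g * k, mul_smul g k a⟩

theorem map_mem_closure_orbit {f : A → B} (hf : Continuous f)
    (hs : ∀ (g : G) (a : A), f (g • a) = g • f a) {a a' : A} (h : a' ∈ closure (orbit G a)) :
    f a' ∈ closure (orbit G (f a)) := by
  rw [← image_orbit_of_map_smul hs]
  exact image_closure_subset_closure_image hf ⟨a', h, rfl⟩

/-- Orbit closures lift along continuous equivariant maps out of a compact system. -/
theorem exists_mem_closure_orbit_of_map [CompactSpace A] [T2Space B] {f : A → B}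
    (hf : Continuous f) (hs : ∀ (g : G) (a : A), f (g • a) = g • f a) {a : A} {b : B}
    (h : b ∈ closure (orbit G (f a))) : ∃ a' ∈ closure (orbit G a), f a' = b := by
  rwa [← image_orbit_of_map_smul hs,
    ← image_closure_of_isCompact isClosed_closure.isCompact hf.continuousOn] at h

theorem exists_dense_orbit_of_isTopologicallyTransitive [ContinuousConstSMul G A]
    [SecondCountableTopology A] [BaireSpace A] [Nonempty A]
    (h : IsTopologicallyTransitive G A) : ∃ a : A, Dense (orbit G a) := by
  have hD : Dense (⋂ U ∈ TopologicalSpace.countableBasis A, ⋃ g : G, (fun x : A => g • x) ⁻¹' U) :=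
    dense_biInter_of_isOpen
      (fun U hU => isOpen_iUnion fun g =>
        (TopologicalSpace.isOpen_of_mem_countableBasis hU).preimage (continuous_const_smul g))
      (TopologicalSpace.countable_countableBasis A)
      (fun U hU => (TopologicalSpace.isOpen_of_mem_countableBasis hU).dense_iUnion_preimage_smul G
        (TopologicalSpace.nonempty_of_mem_countableBasis hU))
  obtain ⟨a, ha⟩ := hD.nonempty
  refine ⟨a, (TopologicalSpace.isBasis_countableBasis A).dense_iff.2 fun U hU _ => ?_⟩
  obtain ⟨g, hg⟩ := Set.mem_iUnion.1 (Set.mem_iInter₂.1 ha U hU)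
  exact ⟨g • a, hg, g, rfl⟩

end Orbits

/-! ### The enveloping semigroup of a distal system -/

section Enveloping

variable {G X : Type*} [Group G] [TopologicalSpace X] [MulAction G X]

/-- Composition on the right by a fixed self-map of `X` is continuous and equivariant on `X ^ X`,
with no continuity required of that self-map. -/
theorem comp_mem_closure_orbit {p q : X → X} (h : q ∈ closure (orbit G p)) (r : X → X) :
    q ∘ r ∈ closure (orbit G (p ∘ r)) :=
  map_mem_closure_orbit (f := fun f : X → X => f ∘ r)
    (continuous_pi fun x => continuous_apply (r x)) (fun _ _ => rfl) h

variable [ContinuousConstSMul G X]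

theorem mem_envelopingSemigroup_iff {p : X → X} :
    p ∈ EnvelopingSemigroup G X ↔ p ∈ closure (orbit G (id : X → X)) := Iff.rfl

theorem id_mem_envelopingSemigroup : (id : X → X) ∈ EnvelopingSemigroup G X :=
  mem_envelopingSemigroup_iff.2 (mem_closure_orbit_self _)

theorem comp_mem_envelopingSemigroup {p q : X → X} (hp : p ∈ EnvelopingSemigroup G X)
    (hq : q ∈ EnvelopingSemigroup G X) : p ∘ q ∈ EnvelopingSemigroup G X :=
  mem_closure_orbit_trans (G := G) (a := (id : X → X)) hq (comp_mem_closure_orbit hp q)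

theorem eq_id_of_comp_self (hX : IsDistal G X) {u : X → X} (hu : u ∈ EnvelopingSemigroup G X)
    (huu : u ∘ u = u) : u = id := by
  funext x
  have hmem : (u x, u x) ∈ closure (orbit G (x, u x)) := by
    have := map_mem_closure_orbit (G := G) (a := (id : X → X)) (f := fun f : X → X => (f x, f (u x)))
      ((continuous_apply x).prodMk (continuous_apply (u x))) (fun _ _ => rfl) hu
    simpa only [id, show u (u x) = u x from congrFun huu x] using this
  have hprox : (x, u x) ∈ proximalRelation G X := ⟨_, hmem, rfl⟩
  rw [hX] at hprox
  exact Eq.symm hprox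

theorem id_mem_of_isClosed_of_comp_mem [CompactSpace X] [T2Space X] (hX : IsDistal G X)
    {S : Set (X → X)} (hSE : S ⊆ EnvelopingSemigroup G X) (hne : S.Nonempty) (hS : IsClosed S)
    (hcomp : ∀ p ∈ S, ∀ q ∈ S, p ∘ q ∈ S) : id ∈ S := by
  let _ : Semigroup (X → X) := { mul := fun p q => p ∘ q, mul_assoc := fun _ _ _ => rfl }
  obtain ⟨u, hu, huu⟩ := exists_idempotent_in_compact_subsemigroup (M := X → X)
    (fun r => continuous_pi fun x => continuous_apply (r x)) S hne hS.isCompact hcomp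
  exact eq_id_of_comp_self hX (hSE hu) huu ▸ hu

/-- A closed subsemigroup of the enveloping semigroup of a distal system has left inverses. -/
theorem exists_comp_eq_id [CompactSpace X] [T2Space X] (hX : IsDistal G X)
    {S : Set (X → X)} (hSE : S ⊆ EnvelopingSemigroup G X) (hS : IsClosed S)
    (hcomp : ∀ p ∈ S, ∀ q ∈ S, p ∘ q ∈ S) {s : X → X} (hs : s ∈ S) : ∃ t ∈ S, t ∘ s = id := by
  have hcont : Continuous fun f : X → X => f ∘ s := continuous_pi fun x => continuous_apply (s x)
  -- The left ideal `S s` is again a closed subsemigroup, being a continuous image of `S`.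
  refine id_mem_of_isClosed_of_comp_mem hX (S := (fun f : X → X => f ∘ s) '' S) ?_
    ⟨_, s, hs, rfl⟩ (hS.isCompact.image hcont).isClosed ?_
  · rintro _ ⟨t, ht, rfl⟩
    exact hSE (hcomp t ht s hs)
  · rintro _ ⟨t, ht, rfl⟩ _ ⟨t', ht', rfl⟩
    exact ⟨t ∘ s ∘ t', hcomp t ht _ (hcomp s hs t' ht'), rfl⟩

/-- The enveloping semigroup of a distal system is a group. -/
theorem exists_inverse_mem_envelopingSemigroup [CompactSpace X] [T2Space X] (hX : IsDistal G X)
    {p : X → X} (hp : p ∈ EnvelopingSemigroup G X) :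
    ∃ q ∈ EnvelopingSemigroup G X, q ∘ p = id ∧ p ∘ q = id := by
  have key : ∀ p ∈ EnvelopingSemigroup G X, ∃ q ∈ EnvelopingSemigroup G X, q ∘ p = id :=
    fun p hp => exists_comp_eq_id hX (S := EnvelopingSemigroup G X) subset_rfl isClosed_closure
      (fun _ h _ h' => comp_mem_envelopingSemigroup h h') hp
  obtain ⟨q, hq, hqp⟩ := key p hp
  obtain ⟨r, -, hrq⟩ := key q hq
  have hrp : r = p := by
    calc r = r ∘ (q ∘ p) := by rw [hqp]; rfl
      _ = (r ∘ q) ∘ p := rfl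
      _ = p := by rw [hrq]; rfl
  exact ⟨q, hq, hqp, hrp ▸ hrq⟩

end Enveloping

/-! ### Orbit closures in the product of a minimal system and an enveloping semigroup -/

section Product

variable {G X Y : Type*} [Group G] [TopologicalSpace X] [MulAction G X]
  [TopologicalSpace Y] [MulAction G Y]

theorem prod_comp_mem_closure_orbit {y y' : Y} {p q : X → X}
    (h : (y', q) ∈ closure (orbit G (y, p))) (r : X → X) :
    (y', q ∘ r) ∈ closure (orbit G (y, p ∘ r)) :=
  map_mem_closure_orbit (f := fun a : Y × (X → X) => (a.1, a.2 ∘ r))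
    (continuous_fst.prodMk (continuous_pi fun x => (continuous_apply (r x)).comp continuous_snd))
    (fun _ _ => rfl) h

theorem snd_mem_closure_orbit {y y' : Y} {p q : X → X}
    (h : (y', q) ∈ closure (orbit G (y, p))) : q ∈ closure (orbit G p) :=
  map_mem_closure_orbit (f := fun a : Y × (X → X) => a.2) continuous_snd (fun _ _ => rfl) h

variable [ContinuousConstSMul G X]

/-- Orbit closures in `Y × E` are traces of those in `Y × X ^ X`. -/
theorem mem_closure_orbit_prod_subtype_iff {a b : Y × EnvelopingSemigroup G X} :
    b ∈ closure (orbit G a) ↔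
      (b.1, (b.2 : X → X)) ∈ closure (orbit G (a.1, (a.2 : X → X))) := by
  have hind : IsInducing (Prod.map id Subtype.val : Y × EnvelopingSemigroup G X → Y × (X → X)) :=
    IsInducing.id.prodMap IsInducing.subtypeVal
  rw [hind.closure_eq_preimage_closure_image, image_orbit_of_map_smul (G := G) fun _ _ => rfl]
  rfl

variable [ContinuousConstSMul G Y]

/-- Points over the same point of `Y` reach each other symmetrically, as the return set of
`(y, id)` in `E` is a closed subsemigroup of a group, hence closed under inverses. -/
theorem mem_closure_orbit_symm_of_fst_eq [CompactSpace X] [T2Space X] (hX : IsDistal G X)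
    {y : Y} {p q : X → X} (hp : p ∈ EnvelopingSemigroup G X)
    (h : (y, q) ∈ closure (orbit G (y, p))) : (y, p) ∈ closure (orbit G (y, q)) := by
  let S : Set (X → X) := {s | (y, s) ∈ closure (orbit G (y, (id : X → X)))}
  obtain ⟨p', -, hp'p, hpp'⟩ := exists_inverse_mem_envelopingSemigroup hX hp
  have hs : q ∘ p' ∈ S := by
    have := prod_comp_mem_closure_orbit h p'
    rwa [hpp'] at this
  obtain ⟨t, ht, hts⟩ := exists_comp_eq_id hX (S := S) (fun s hs => snd_mem_closure_orbit hs)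
    (isClosed_closure.preimage (continuous_const.prodMk continuous_id))
    (fun a ha b hb => mem_closure_orbit_trans hb (prod_comp_mem_closure_orbit ha b)) hs
  have := prod_comp_mem_closure_orbit ht q
  rwa [show t ∘ q = p by
    calc t ∘ q = t ∘ q ∘ (p' ∘ p) := by rw [hp'p]; rfl
      _ = (t ∘ q ∘ p') ∘ p := rfl
      _ = p := by rw [hts]; rfl] at this

/-- `Y × E` is a union of minimal sets when `Y` is minimal and `X` is distal. -/
theorem mem_closure_orbit_symm [CompactSpace X] [T2Space X] [CompactSpace Y] [T2Space Y]
    (hX : IsDistal G X) (hY : IsMinimal G Y) {y y' : Y} {p q : X → X}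
    (hp : p ∈ EnvelopingSemigroup G X) (h : (y', q) ∈ closure (orbit G (y, p))) :
    (y, p) ∈ closure (orbit G (y', q)) := by
  obtain ⟨⟨_, r⟩, hr, rfl⟩ := exists_mem_closure_orbit_of_map (G := G) (A := Y × (X → X))
    (f := Prod.fst) (a := (y', q)) continuous_fst (fun _ _ => rfl) (hY.dense_orbit y' y)
  exact mem_closure_orbit_trans hr
    (mem_closure_orbit_symm_of_fst_eq hX hp (mem_closure_orbit_trans h hr))

theorem mem_closure_orbit_of_isWeaklyMixing [CompactSpace X] [T2Space X]
    [CompactSpace Y] [T2Space Y] [SecondCountableTopology Y]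
    (hX : IsDistal G X) (hY : IsMinimal G Y) (hmix : IsWeaklyMixing G Y) {y y' : Y} {p p' : X → X}
    (hp : p ∈ EnvelopingSemigroup G X) (hp' : p' ∈ EnvelopingSemigroup G X) :
    (y', p') ∈ closure (orbit G (y, p)) := by
  have : Nonempty Y := ⟨y⟩
  obtain ⟨⟨y₁, y₂⟩, hdense⟩ := exists_dense_orbit_of_isTopologicallyTransitive hmix
  have hlift : ∀ a b : Y, ∃ q ∈ EnvelopingSemigroup G X,
      (a, q) ∈ closure (orbit G (y₁, (id : X → X))) ∧
      (b, q) ∈ closure (orbit G (y₂, (id : X → X))) := by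
    intro a b
    obtain ⟨⟨⟨_, _⟩, q⟩, hq, hab⟩ := exists_mem_closure_orbit_of_map (G := G)
      (A := (Y × Y) × (X → X)) (f := Prod.fst) (a := ((y₁, y₂), id))
      continuous_fst (fun _ _ => rfl) (hdense (a, b))
    cases hab
    exact ⟨q, snd_mem_closure_orbit hq,
      map_mem_closure_orbit (f := fun c : (Y × Y) × (X → X) => (c.1.1, c.2))
        (by fun_prop) (fun _ _ => rfl) hq,
      map_mem_closure_orbit (f := fun c : (Y × Y) × (X → X) => (c.1.2, c.2))
        (by fun_prop) (fun _ _ => rfl) hq⟩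
  -- Proximality of `y₁` and `y₂` identifies the classes of `(y₁, id)` and `(y₂, id)`.
  have h12 : (y₂, (id : X → X)) ∈ closure (orbit G (y₁, (id : X → X))) := by
    obtain ⟨q, -, h1, h2⟩ := hlift y₁ y₁
    exact mem_closure_orbit_trans h1
      (mem_closure_orbit_symm hX hY id_mem_envelopingSemigroup h2)
  have hsame : ∀ (a b : Y) (r : X → X), (b, r) ∈ closure (orbit G (a, r)) := by
    intro a b r
    obtain ⟨q, hq, h1, h2⟩ := hlift a b
    obtain ⟨q', -, -, hqq'⟩ := exists_inverse_mem_envelopingSemigroup hX hq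
    have := prod_comp_mem_closure_orbit (mem_closure_orbit_trans
      (mem_closure_orbit_symm hX hY id_mem_envelopingSemigroup h1)
      (mem_closure_orbit_trans h12 h2)) (q' ∘ r)
    rwa [show q ∘ q' ∘ r = r by rw [← Function.comp_assoc, hqq']; rfl] at this
  have hpp' : p' ∈ closure (orbit G p) := by
    obtain ⟨s, hs, hsp, -⟩ := exists_inverse_mem_envelopingSemigroup hX hp
    have := comp_mem_closure_orbit (comp_mem_envelopingSemigroup hp' hs) p
    rwa [Function.comp_assoc, hsp] at this
  obtain ⟨⟨z, _⟩, hz, rfl⟩ := exists_mem_closure_orbit_of_map (G := G) (A := Y × (X → X))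
    (f := Prod.snd) (a := (y, p)) continuous_snd (fun _ _ => rfl) hpp'
  exact mem_closure_orbit_trans hz (hsame z y' _)

theorem areDisjoint_envelopingSemigroup_of_isWeaklyMixing [CompactSpace X] [T2Space X]
    [CompactSpace Y] [T2Space Y] [SecondCountableTopology Y]
    (hX : IsDistal G X) (hY : IsMinimal G Y) (hmix : IsWeaklyMixing G Y) :
    AreDisjoint G Y (EnvelopingSemigroup G X) :=
  ⟨fun a b => mem_closure_orbit_prod_subtype_iff.2
    (mem_closure_orbit_of_isWeaklyMixing hX hY hmix a.2.2 b.2.2)⟩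

end Product

/-! ### Factors of `Y × X` over `Y` -/

section Factors

variable {G X Y Q : Type*} [Group G] [TopologicalSpace X] [MulAction G X] [ContinuousConstSMul G X]
  [TopologicalSpace Y] [MulAction G Y] [TopologicalSpace Q] [MulAction G Q]

/-- The relation that an equivariant map induces on the fibre over a point of `Y` does not depend
on that point when `Y` is disjoint from the enveloping semigroup of `X`. -/
theorem map_eq_map_of_areDisjoint [T2Space Q] (h : AreDisjoint G Y (EnvelopingSemigroup G X))
    {φ : Y × X → Q} (hφ : Continuous φ) (hs : ∀ (g : G) (a : Y × X), φ (g • a) = g • φ a)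
    {y : Y} {x x' : X} (hxx' : φ (y, x) = φ (y, x')) (y' : Y) : φ (y', x) = φ (y', x') := by
  have hreach : (y', (id : X → X)) ∈ closure (orbit G (y, (id : X → X))) :=
    mem_closure_orbit_prod_subtype_iff.1
      (h.dense_orbit (y, (⟨id, id_mem_envelopingSemigroup⟩ : EnvelopingSemigroup G X))
        (y', ⟨id, id_mem_envelopingSemigroup⟩))
  have hclosed : IsClosed {a : Y × (X → X) | φ (a.1, a.2 x) = φ (a.1, a.2 x')} :=
    isClosed_eq (by fun_prop) (by fun_prop)
  refine closure_minimal (t := {a : Y × (X → X) | φ (a.1, a.2 x) = φ (a.1, a.2 x')})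
    ?_ hclosed hreach
  rintro _ ⟨g, rfl⟩
  exact (hs g (y, x)).trans ((congrArg (g • ·) hxx').trans (hs g (y, x')).symm)

/-- The quotient of a system by an invariant equivalence relation. -/
abbrev quotientMulAction (r : Setoid X) (hr : ∀ (g : G) (x x' : X), r x x' → r (g • x) (g • x')) :
    MulAction G (Quotient r) where
  smul g := Quotient.map (g • ·) (hr g)
  one_smul := by
    rintro ⟨x⟩
    exact congrArg (Quotient.mk r) (one_smul G x)
  mul_smul g k := by
    rintro ⟨x⟩
    exact congrArg (Quotient.mk r) (mul_smul g k x)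

end Factors

/-- The factor `Z` is the quotient of `X` by the relation that `φ` induces over one point of `Y`;
`φ` and `Y × X → Y × Z` are then quotient maps with the same fibres. -/
theorem exists_factor_homeomorph_prod {G : Type*} {X : Type u} {Y : Type v} {Q : Type w} [Group G]
    [TopologicalSpace X] [CompactSpace X] [MulAction G X] [ContinuousConstSMul G X]
    [TopologicalSpace Y] [CompactSpace Y] [T2Space Y] [MulAction G Y] [ContinuousConstSMul G Y]
    [TopologicalSpace Q] [CompactSpace Q] [TopologicalSpace.MetrizableSpace Q] [MulAction G Q]
    [Nonempty Y]
    (hdisj : AreDisjoint G Y (EnvelopingSemigroup G X)) {φ : Y × X → Q} {θ : Q → Y}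
    (hφ : IsFactorMap G φ) (hθφ : ∀ p : Y × X, θ (φ p) = p.1) :
    ∃ (Z : Type u) (_ : TopologicalSpace Z) (_ : CompactSpace Z)
      (_ : TopologicalSpace.MetrizableSpace Z) (_ : MulAction G Z) (_ : ContinuousConstSMul G Z),
      (∃ π : X → Z, IsFactorMap G π) ∧
      ∃ h : Q ≃ₜ Y × Z, (∀ (g : G) (q : Q), h (g • q) = g • h q) ∧ ∀ q : Q, (h q).1 = θ q := by
  obtain ⟨y₀⟩ := ‹Nonempty Y›
  have hfib : ∀ (y y' : Y) {x x' : X}, φ (y, x) = φ (y, x') → φ (y', x) = φ (y', x') :=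
    fun y y' _ _ h => map_eq_map_of_areDisjoint hdisj hφ.continuous hφ.map_smul h y'
  let r : Setoid X := Setoid.ker fun x => φ (y₀, x)
  have hr : ∀ (g : G) (x x' : X), r x x' → r (g • x) (g • x') := fun g x x' h =>
    hfib (g • y₀) y₀ ((hφ.map_smul g (y₀, x)).trans
      ((congrArg (g • ·) h).trans (hφ.map_smul g (y₀, x')).symm))
  let _ : MulAction G (Quotient r) := quotientMulAction r hr
  have hcont : ContinuousConstSMul G (Quotient r) :=
    ⟨fun g => (continuous_quotient_mk'.comp (continuous_const_smul g)).quotient_lift _⟩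
  -- The quotient is metrizable since it embeds in the fibre of `θ` over `y₀`.
  have hι : IsEmbedding (Quotient.lift (fun x => φ (y₀, x)) fun _ _ h => h : Quotient r → Q) := by
    refine (IsClosedEmbedding.of_continuous_injective_isClosedMap ?_ ?_ ?_).isEmbedding
    · exact (hφ.continuous.comp (by fun_prop)).quotient_lift _
    · rintro ⟨x⟩ ⟨x'⟩ h
      exact Quotient.sound h
    · exact ((hφ.continuous.comp (by fun_prop)).quotient_lift _).isClosedMap
  have hmetr : TopologicalSpace.MetrizableSpace (Quotient r) := hι.metrizableSpace
  have hφq : IsQuotientMap φ := hφ.continuous.isClosedMap.isQuotientMap hφ.continuous hφ.surjective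
  -- The coordinate of `Q` in the quotient, read off along the surjection `φ`.
  have hsec : ∀ q : Q, φ (θ q, (Function.surjInv hφ.surjective q).2) = q := fun q => by
    have h := Function.surjInv_eq hφ.surjective q
    have h1 : (Function.surjInv hφ.surjective q).1 = θ q := by rw [← hθφ, h]
    rw [← h1]
    exact h
  let f : Q → Y × Quotient r := fun q => (θ q, Quotient.mk r (Function.surjInv hφ.surjective q).2)
  have hf : ∀ (y : Y) (x : X), f (φ (y, x)) = (y, Quotient.mk r x) := fun y x => by
    refine Prod.ext (hθφ _) (Quotient.sound (hfib y y₀ ?_))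
    have h := hsec (φ (y, x))
    rwa [hθφ] at h
  have hfc : Continuous f := hφq.continuous_iff.2 <| by
    rw [show f ∘ φ = Prod.map id (Quotient.mk r) from funext fun p => hf p.1 p.2]
    exact continuous_id.prodMap continuous_quotient_mk'
  have hfb : Function.Bijective f := by
    constructor
    · intro q q' h
      obtain ⟨⟨y, x⟩, rfl⟩ := hφ.surjective q
      obtain ⟨⟨y', x'⟩, rfl⟩ := hφ.surjective q'
      rw [hf, hf, Prod.mk.injEq] at h
      obtain ⟨rfl, h⟩ := h
      exact hfib y₀ y (Quotient.exact h)
    · rintro ⟨y, ⟨x⟩⟩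
      exact ⟨φ (y, x), hf y x⟩
  refine ⟨Quotient r, inferInstance, inferInstance, hmetr, inferInstance, hcont,
    ⟨Quotient.mk r, continuous_quotient_mk', Quotient.mk_surjective, fun _ _ => rfl⟩,
    Continuous.homeoOfEquivCompactToT2 (f := Equiv.ofBijective f hfb) hfc, ?_, fun _ => rfl⟩
  intro g q
  obtain ⟨⟨y, x⟩, rfl⟩ := hφ.surjective q
  change f (g • φ (y, x)) = g • f (φ (y, x))
  rw [← hφ.map_smul, hf, hf]
  rfl

end TopDyn

theorem theorem3p2 {G : Type*} [Group G]
    {X : Type u} [TopologicalSpace X] [CompactSpace X] [TopologicalSpace.MetrizableSpace X]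
    [MulAction G X] [ContinuousConstSMul G X]
    {Y : Type v} [TopologicalSpace Y] [CompactSpace Y] [TopologicalSpace.MetrizableSpace Y]
    [MulAction G Y] [ContinuousConstSMul G Y]
    (hXmin : MulAction.IsMinimal G X) (hXdistal : TopDyn.IsDistal G X)
    (hYmin : MulAction.IsMinimal G Y) :
    (TopDyn.IsWeaklyMixing G Y →
      TopDyn.AreDisjoint G Y (TopDyn.EnvelopingSemigroup G X)) ∧
    (TopDyn.AreDisjoint G Y (TopDyn.EnvelopingSemigroup G X) →
      ∀ (Q : Type w) [TopologicalSpace Q] [CompactSpace Q] [TopologicalSpace.MetrizableSpace Q]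
        [MulAction G Q] [ContinuousConstSMul G Q]
        (φ : Y × X → Q) (θ : Q → Y),
        TopDyn.IsFactorMap G φ → TopDyn.IsFactorMap G θ → (∀ p : Y × X, θ (φ p) = p.1) →
        ∃ (Z : Type u) (_ : TopologicalSpace Z) (_ : CompactSpace Z)
          (_ : TopologicalSpace.MetrizableSpace Z) (_ : MulAction G Z)
          (_ : ContinuousConstSMul G Z),
          (∃ π : X → Z, TopDyn.IsFactorMap G π) ∧
          ∃ h : Q ≃ₜ Y × Z,
            (∀ (g : G) (q : Q), h (g • q) = g • h q) ∧ ∀ q : Q, (h q).1 = θ q) := by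
  have : SecondCountableTopology Y := by
    let _ := TopologicalSpace.metrizableSpaceMetric Y
    infer_instance
  refine ⟨TopDyn.areDisjoint_envelopingSemigroup_of_isWeaklyMixing hXdistal hYmin, ?_⟩
  intro hdisj Q _ _ _ _ _ φ θ hφ _ hθφ
  cases isEmpty_or_nonempty Y with
  | inl hY =>
    -- Over an empty base `Q` is empty as well, and `X` itself serves as the factor.
    have : IsEmpty Q := ⟨fun q => hY.elim (θ q)⟩
    exact ⟨X, inferInstance, inferInstance, inferInstance, inferInstance, inferInstance,
      ⟨id, continuous_id, Function.surjective_id, fun _ _ => rfl⟩,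
      Homeomorph.empty, fun _ q => isEmptyElim q, fun q => isEmptyElim q⟩
  | inr _ => exact TopDyn.exists_factor_homeomorph_prod hdisj hφ hθφ
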